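/- Let $X$ and $Y$ be sets (possibly infinite or empty) and let $k$ be a field. Let $R = k\langle X\rangle * k[Y]$ be the coproduct, in the category of associative unital $k$-algebras, of the free associative algebra $k\langle X\rangle$ on $X$ and the polynomial algebra $k[Y]$ on $Y$; equivalently, $R$ is the monoid algebra over $k$ of the coproduct of the free monoid on $X$ and the free commutative monoid on $Y$. Let $u \in R$ be nonscalar, i.e. $u \notin k\cdot 1$. Then the centralizer $C(u) = \{a \in R : au = ua\}$ is commutative: $ab = ba$ for all $a, b \in C(u)$. -/

import Mathlib

/-- The monoid `⟨X⟩ * [Y]`: the coproduct of the free monoid on `X` and the free commutative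
monoid on `Y` (written multiplicatively). -/
abbrev CoprodMonoid (X Y : Type*) : Type _ :=
  Monoid.Coprod (FreeMonoid X) (Multiplicative (Y →₀ ℕ))

/-- The algebra `k⟨X⟩ * k[Y]`, realized as the monoid algebra of `⟨X⟩ * [Y]` over `k`.
That it is the coproduct of `k⟨X⟩` and `k[Y]` in the category of associative unital `k`-algebras
is proved below, in `FreePolyCoprod.existsUnique_lift`. -/
abbrev FreePolyCoprod (k X Y : Type*) [Field k] : Type _ :=
  MonoidAlgebra k (CoprodMonoid X Y)

namespace FreePolyCoprod

/-- The canonical map `k⟨X⟩ → k⟨X⟩ * k[Y]`. -/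
noncomputable def inl (k X Y : Type*) [Field k] : FreeAlgebra k X →ₐ[k] FreePolyCoprod k X Y :=
  FreeAlgebra.lift k fun x =>
    MonoidAlgebra.of k (CoprodMonoid X Y) (Monoid.Coprod.inl (FreeMonoid.of x))

/-- The canonical map `k[Y] → k⟨X⟩ * k[Y]`. -/
noncomputable def inr (k X Y : Type*) [Field k] : MvPolynomial Y k →ₐ[k] FreePolyCoprod k X Y :=
  AddMonoidAlgebra.lift k (FreePolyCoprod k X Y) (Y →₀ ℕ)
    ((MonoidAlgebra.of k (CoprodMonoid X Y)).comp Monoid.Coprod.inr)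

/-- The universal property of the coproduct of `k⟨X⟩` and `k[Y]`. -/
theorem existsUnique_lift (k X Y : Type*) [Field k] {A : Type*} [Semiring A] [Algebra k A]
    (f : FreeAlgebra k X →ₐ[k] A) (g : MvPolynomial Y k →ₐ[k] A) :
    ∃! h : FreePolyCoprod k X Y →ₐ[k] A, h.comp (inl k X Y) = f ∧ h.comp (inr k X Y) = g := by
  let G : Multiplicative (Y →₀ ℕ) →* A := (AddMonoidAlgebra.lift k A (Y →₀ ℕ)).symm g
  let F : FreeMonoid X →* A := FreeMonoid.lift fun x => f (FreeAlgebra.ι k x)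
  refine ⟨MonoidAlgebra.lift k A _ (Monoid.Coprod.lift F G), ⟨?_, ?_⟩, ?_⟩
  · ext x
    simp [inl, F]
  · apply (AddMonoidAlgebra.lift k A (Y →₀ ℕ)).symm.injective
    ext m
    simp [inr, G]
  · rintro h ⟨h1, h2⟩
    apply (MonoidAlgebra.lift k A _).symm.injective
    rw [Equiv.symm_apply_apply]
    refine Monoid.Coprod.hom_ext ?_ ?_
    · ext x
      have := DFunLike.congr_fun h1 (FreeAlgebra.ι k x)
      simpa [inl, F] using this
    · refine MonoidHom.ext fun m => ?_
      have := DFunLike.congr_fun h2 (AddMonoidAlgebra.single m.toAdd 1)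
      simpa [inr, G] using this

end FreePolyCoprod

/-! Only finitely many monomials of `u`, `a * b` and `b * a` matter. Sending each letter of `X` to
itself and the monomials of `[Y]` to powers of one new letter, by a well-chosen weight, keeps these
monomials distinct (`exists_monoidHom_freeMonoid_injOn`), so the claim reduces to a free algebra.

There, under the length-lexicographic order, the leading word of an element of `C(u)` commutes with
that of `u`, and is therefore determined by its length. Elements of `C(u)` of equal degree thus
agree up to a scalar and lower terms. Degrees modulo `deg u` form a cyclic group, generated by the
degree of some `p`, so modulo bounded degree `C(u)` consists of polynomials in `p` and `u`.
Multiplying a commutator by a high power of `u` then forces it to vanish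
(`commute_of_commute_of_degree`). -/

/-! ### Commutative centralizers from a degree function. -/

/-- The degrees of the nonzero elements commuting with `u` are, modulo `deg u`, multiples of the
degree of one of them. -/
theorem exists_commute_degree_generator {R : Type*} [Ring R] [NoZeroDivisors R] [Nontrivial R]
    (deg : R → ℕ) (hmul : ∀ a b : R, a ≠ 0 → b ≠ 0 → deg (a * b) = deg a + deg b)
    (u : R) (hu : 0 < deg u) :
    ∃ p : R, p ≠ 0 ∧ Commute p u ∧ ∀ f : R, f ≠ 0 → Commute f u →
      ∃ j < deg u, (deg f : ZMod (deg u)) = (j * deg p : ℕ) := by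
  have hone : deg 1 = 0 := by
    have := hmul 1 1 one_ne_zero one_ne_zero
    rw [mul_one] at this
    omega
  have hpow (a : R) (ha : a ≠ 0) (m : ℕ) : deg (a ^ m) = m * deg a := by
    induction m with
    | zero => simpa using hone
    | succ m ih => rw [pow_succ, hmul _ _ (pow_ne_zero _ ha) ha, ih]; ring
  have : NeZero (deg u) := ⟨hu.ne'⟩
  let T : AddSubgroup (ZMod (deg u)) :=
    { carrier := {x | ∃ f : R, f ≠ 0 ∧ Commute f u ∧ (deg f : ZMod (deg u)) = x}
      zero_mem' := ⟨1, one_ne_zero, Commute.one_left u, by simp [hone]⟩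
      add_mem' := by
        rintro _ _ ⟨f, hf, hfu, rfl⟩ ⟨g, hg, hgu, rfl⟩
        exact ⟨f * g, mul_ne_zero hf hg, hfu.mul_left hgu, by simp [hmul f g hf hg]⟩
      neg_mem' := by
        rintro _ ⟨f, hf, hfu, rfl⟩
        refine ⟨f ^ (deg u - 1), pow_ne_zero _ hf, hfu.pow_left _, ?_⟩
        rw [hpow f hf]
        push_cast [Nat.cast_sub (show 1 ≤ deg u from hu)]
        simp }
  obtain ⟨⟨_, p, hp, hpu, rfl⟩, hgen⟩ := IsAddCyclic.exists_generator (α := T)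
  refine ⟨p, hp, hpu, fun f hf hfu => ?_⟩
  obtain ⟨z, hz⟩ := AddSubgroup.mem_zmultiples_iff.1 (hgen ⟨_, f, hf, hfu, rfl⟩)
  have hz' : z • (deg p : ZMod (deg u)) = deg f := congrArg Subtype.val hz
  refine ⟨(z : ZMod (deg u)).val, ZMod.val_lt _, ?_⟩
  rw [← hz']
  simp

/-- If elements of equal degree commuting with `u` agree up to a scalar and lower degree terms,
then the centralizer of `u` is commutative. -/
theorem commute_of_commute_of_degree {k R : Type*} [Field k] [Ring R] [Algebra k R]
    [NoZeroDivisors R] [Nontrivial R]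
    (deg : R → ℕ) (hzero : deg 0 = 0)
    (hmul : ∀ a b : R, a ≠ 0 → b ≠ 0 → deg (a * b) = deg a + deg b)
    (hsub : ∀ a b : R, deg (a - b) ≤ max (deg a) (deg b))
    (u : R) (hu : 0 < deg u)
    (hlead : ∀ a b : R, a ≠ 0 → b ≠ 0 → Commute a u → Commute b u → deg a = deg b →
      ∃ c : k, a - c • b = 0 ∨ deg (a - c • b) < deg a)
    {a b : R} (ha : Commute a u) (hb : Commute b u) : Commute a b := by
  have hu0 : u ≠ 0 := by rintro rfl; omega
  have hone : deg 1 = 0 := by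
    have := hmul 1 1 one_ne_zero one_ne_zero
    rw [mul_one] at this
    omega
  have hpow (a : R) (ha : a ≠ 0) (m : ℕ) : deg (a ^ m) = m * deg a := by
    induction m with
    | zero => simpa using hone
    | succ m ih => rw [pow_succ, hmul _ _ (pow_ne_zero _ ha) ha, ih]; ring
  have hmul_le (a b : R) : deg (a * b) ≤ deg a + deg b := by
    by_cases h : a = 0
    · simp [h, hzero]
    by_cases h' : b = 0
    · simp [h', hzero]
    exact (hmul a b h h').le
  obtain ⟨p, hp, hpu, hgen⟩ := exists_commute_degree_generator deg hmul u hu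
  -- `q` is a polynomial in `p` and `u`; only what commutes with it is recorded.
  have happrox : ∀ (N : ℕ) (f : R), deg f ≤ N → Commute f u →
      ∃ q : R, (∀ x, Commute x p → Commute x u → Commute x q) ∧
        deg (f - q) ≤ deg u * deg p := by
    intro N
    induction N with
    | zero => exact fun f hf _ => ⟨0, fun x _ _ => Commute.zero_right x, by
        rw [sub_zero]; omega⟩
    | succ N ih =>
      intro f hf hfu
      by_cases hB : deg f ≤ deg u * deg p
      · exact ⟨0, fun x _ _ => Commute.zero_right x, by rwa [sub_zero]⟩
      have hf0 : f ≠ 0 := by rintro rfl; omega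
      obtain ⟨j, hj, hjf⟩ := hgen f hf0 hfu
      -- Since `j < deg u`, the bound `deg u * deg p` makes the excess degree a nonnegative multiple
      -- of `deg u`, supplied by `u ^ l`.
      have hle : j * deg p ≤ deg f :=
        (Nat.mul_le_mul_right _ hj.le).trans (not_le.1 hB).le
      obtain ⟨l, hl⟩ : deg u ∣ deg f - j * deg p :=
        (Nat.modEq_iff_dvd' hle).1 ((ZMod.natCast_eq_natCast_iff _ _ _).1 hjf.symm)
      have hq : ∀ x, Commute x p → Commute x u → Commute x (p ^ j * u ^ l) :=
        fun x h h' => (h.pow_right j).mul_right (h'.pow_right l)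
      have hpj := pow_ne_zero j hp
      have hul := pow_ne_zero l hu0
      have hdeg : deg f = deg (p ^ j * u ^ l) := by
        rw [hmul _ _ hpj hul, hpow p hp, hpow u hu0, mul_comm l, ← hl]; omega
      have hqu : Commute (p ^ j * u ^ l) u := (hq u hpu.symm (Commute.refl u)).symm
      obtain ⟨c, hc⟩ := hlead f _ hf0 (mul_ne_zero hpj hul) hfu hqu hdeg
      have hlt : deg (f - c • (p ^ j * u ^ l)) ≤ N := by
        rcases hc with hc | hc
        · rw [hc, hzero]; omega
        · omega
      obtain ⟨q, hqc, hqd⟩ := ih _ hlt (hfu.sub_left (hqu.smul_left c))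
      refine ⟨c • (p ^ j * u ^ l) + q, fun x h h' => ((hq x h h').smul_right c).add_right
        (hqc x h h'), ?_⟩
      rwa [← sub_sub]
  have hcomm : ∀ f g : R, Commute f u → Commute g u → Commute g p → Commute f g := by
    intro f g hf hg hgp
    by_contra hne
    have hd : f * g - g * f ≠ 0 := fun h => hne (sub_eq_zero.1 h)
    -- Both `q` and the power of `u` commute with `g`, so `[f, g] * u ^ N = [f * u ^ N - q, g]`. The
    -- right side has degree at most `deg u * deg p + deg g`, which is less than `N`.
    obtain ⟨q, hq, hqd⟩ := happrox _ (f * u ^ (deg u * deg p + deg g + 1)) le_rfl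
      (hf.mul_left ((Commute.refl u).pow_left _))
    have hgq := (hq g hgp hg).eq
    have hgu := (hg.pow_right (deg u * deg p + deg g + 1)).eq
    have hkey : (f * g - g * f) * u ^ (deg u * deg p + deg g + 1) =
        (f * u ^ (deg u * deg p + deg g + 1) - q) * g -
          g * (f * u ^ (deg u * deg p + deg g + 1) - q) := by
      simp only [sub_mul, mul_sub, mul_assoc, hgu, hgq]
      abel
    have h1 := congrArg deg hkey
    rw [hmul _ _ hd (pow_ne_zero _ hu0), hpow u hu0] at h1
    have h2 := hsub ((f * u ^ (deg u * deg p + deg g + 1) - q) * g)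
      (g * (f * u ^ (deg u * deg p + deg g + 1) - q))
    have h3 := hmul_le (f * u ^ (deg u * deg p + deg g + 1) - q) g
    have h4 := hmul_le g (f * u ^ (deg u * deg p + deg g + 1) - q)
    have h5 := Nat.le_mul_of_pos_right (deg u * deg p + deg g + 1) hu
    rcases le_max_iff.1 h2 with h | h <;> omega
  -- Taking `g = p` first shows that `b` commutes with `p`.
  exact hcomm a b ha hb (hcomm b p hb hpu (Commute.refl p))

/-! ### Leading words and centralizers in free algebras. -/

/-- The leading monomial of a product is the product of the leading monomials. -/
theorem MonoidAlgebra.isGreatest_support_mul {k M : Type*} [Semiring k] [NoZeroDivisors k]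
    [Monoid M] [LinearOrder M] [MulLeftStrictMono M] [MulRightStrictMono M]
    {f g : MonoidAlgebra k M} {m n : M}
    (hf : IsGreatest (f.coeff.support : Set M) m) (hg : IsGreatest (g.coeff.support : Set M) n) :
    IsGreatest ((f * g).coeff.support : Set M) (m * n) := by
  classical
  have := mulLeftMono_of_mulLeftStrictMono M
  have := mulRightMono_of_mulRightStrictMono M
  constructor
  · have huniq : UniqueMul f.coeff.support g.coeff.support m n := by
      intro a b ha hb hab
      exact (mul_eq_mul_iff_eq_and_eq (hf.2 ha) (hg.2 hb)).1 hab
    have h1 := hf.1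
    have h2 := hg.1
    simp only [Finset.mem_coe, Finsupp.mem_support_iff] at h1 h2 ⊢
    rw [MonoidAlgebra.coeff_mul_mul_of_uniqueMul huniq]
    exact mul_ne_zero h1 h2
  · intro x hx
    obtain ⟨a, ha, b, hb, rfl⟩ := Finset.mem_mul.1 (MonoidAlgebra.support_coeff_mul_subset f g hx)
    exact mul_le_mul' (hf.2 ha) (hg.2 hb)

/-- A nonzero element has a leading monomial. -/
theorem MonoidAlgebra.exists_isGreatest_support {k M : Type*} [Semiring k] [LinearOrder M]
    {f : MonoidAlgebra k M} (hf : f ≠ 0) :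
    ∃ m, IsGreatest (f.coeff.support : Set M) m := by
  have h : f.coeff.support.Nonempty :=
    Finsupp.support_nonempty_iff.2 (mt MonoidAlgebra.coeff_eq_zero.1 hf)
  exact ⟨_, Finset.isGreatest_max' _ h⟩

/-- The length-lexicographic order on a free monoid. -/
noncomputable abbrev FreeMonoid.shortlexOrder (α : Type*) [LinearOrder α] :
    LinearOrder (FreeMonoid α) :=
  LinearOrder.lift' (fun w : FreeMonoid α => toLex (w.length, w.toList))
    fun _ _ h => FreeMonoid.toList.injective (Prod.ext_iff.1 (toLex.injective h)).2

theorem FreeMonoid.shortlexOrder_lt_iff {α : Type*} [LinearOrder α] {v w : FreeMonoid α} :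
    (FreeMonoid.shortlexOrder α).lt v w ↔
      v.length < w.length ∨ v.length = w.length ∧ v.toList < w.toList :=
  Prod.Lex.toLex_lt_toLex

/-- Equal length excludes proper prefixes, for which appending can reverse the order: `[] < [1]` but
`[1, 2] < [2]`. -/
theorem List.append_lt_append_right_of_length_eq {α : Type*} [LinearOrder α] {v w : List α}
    (hl : v.length = w.length) (h : v < w) (t : List α) : v ++ t < w ++ t := by
  induction h with
  | nil => simp at hl
  | rel h => exact List.Lex.rel h
  | cons _ ih => exact List.Lex.cons (ih (by simpa using hl))

theorem FreeMonoid.mulLeftStrictMono_shortlexOrder (α : Type*) [LinearOrder α] :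
    letI := FreeMonoid.shortlexOrder α
    MulLeftStrictMono (FreeMonoid α) := by
  let _ := FreeMonoid.shortlexOrder α
  refine ⟨fun c v w h => ?_⟩
  refine FreeMonoid.shortlexOrder_lt_iff.2 ?_
  rcases FreeMonoid.shortlexOrder_lt_iff.1 h with h | ⟨h, h'⟩
  · left
    simpa using h
  · right
    exact ⟨by simpa using h, List.Lex.append_left _ h' _⟩

theorem FreeMonoid.mulRightStrictMono_shortlexOrder (α : Type*) [LinearOrder α] :
    letI := FreeMonoid.shortlexOrder α
    MulRightStrictMono (FreeMonoid α) := by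
  let _ := FreeMonoid.shortlexOrder α
  refine ⟨fun c v w h => ?_⟩
  refine FreeMonoid.shortlexOrder_lt_iff.2 ?_
  rcases FreeMonoid.shortlexOrder_lt_iff.1 h with h | ⟨h, h'⟩
  · left
    simpa [Function.swap] using h
  · right
    exact ⟨by simpa [Function.swap] using h, List.append_lt_append_right_of_length_eq h h' _⟩

/-- Two words of equal length commuting with the same nonempty word are equal. -/
theorem FreeMonoid.eq_of_commute_of_length_eq {α : Type*} {v v' w : FreeMonoid α}
    (hw : 0 < w.length) (hv : Commute v w) (hv' : Commute v' w) (hl : v.length = v'.length) :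
    v = v' := by
  have hlen : ∀ m : ℕ, (w ^ m).length = m * w.length := by
    intro m
    induction m with
    | zero => simp
    | succ m ih => rw [pow_succ, FreeMonoid.length_mul, ih]; ring
  -- From `x * w ^ n = w ^ n * x` with `n = v.length`, both `x` and the first `n` letters of `w ^ n`
  -- begin the same word; `w ^ n` is long enough as `w` is nonempty.
  have hpre : ∀ x : FreeMonoid α, Commute x w → x.length = v.length →
      x.toList = (w ^ v.length).toList.take v.length := by
    intro x hx hxl
    have h := congrArg (fun y : FreeMonoid α => y.toList.take v.length)
      (hx.pow_right v.length).eq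
    have h1 : x.toList.length = v.length := hxl
    have h2 : v.length ≤ (w ^ v.length).toList.length :=
      (Nat.le_mul_of_pos_right _ hw).trans (hlen v.length).ge
    simp only [FreeMonoid.toList_mul] at h
    rwa [List.take_append_of_le_length h1.ge, List.take_append_of_le_length h2,
      List.take_of_length_le h1.le] at h
  exact FreeMonoid.toList.injective ((hpre v hv rfl).trans (hpre v' hv' hl.symm).symm)

/-- In a free associative algebra, realized as the monoid algebra of a free monoid, the
centralizer of a nonscalar element is commutative. -/
theorem FreeMonoid.commute_of_commute_monoidAlgebra {k α : Type*} [Field k]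
    {u a b : MonoidAlgebra k (FreeMonoid α)}
    (hu : u ∉ Set.range (algebraMap k (MonoidAlgebra k (FreeMonoid α))))
    (ha : Commute a u) (hb : Commute b u) : Commute a b := by
  classical
  let _ : LinearOrder α := linearOrderOfSTO WellOrderingRel
  let _ := FreeMonoid.shortlexOrder α
  have := FreeMonoid.mulLeftStrictMono_shortlexOrder α
  have := FreeMonoid.mulRightStrictMono_shortlexOrder α
  let deg : MonoidAlgebra k (FreeMonoid α) → ℕ := fun f => f.coeff.support.sup FreeMonoid.length
  have hdeg : ∀ {f : MonoidAlgebra k (FreeMonoid α)} {m},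
      IsGreatest (f.coeff.support : Set (FreeMonoid α)) m → deg f = m.length := by
    intro f m hm
    refine le_antisymm (Finset.sup_le fun x hx => ?_) (Finset.le_sup (f := FreeMonoid.length) hm.1)
    by_contra! h
    exact (hm.2 hx).not_gt (FreeMonoid.shortlexOrder_lt_iff.2 (Or.inl h))
  have hmul : ∀ f g : MonoidAlgebra k (FreeMonoid α), f ≠ 0 → g ≠ 0 →
      f * g ≠ 0 ∧ deg (f * g) = deg f + deg g := by
    intro f g hf hg
    obtain ⟨m, hm⟩ := MonoidAlgebra.exists_isGreatest_support hf
    obtain ⟨n, hn⟩ := MonoidAlgebra.exists_isGreatest_support hg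
    have hmn := MonoidAlgebra.isGreatest_support_mul hm hn
    refine ⟨?_, by rw [hdeg hm, hdeg hn, hdeg hmn, FreeMonoid.length_mul]⟩
    intro h
    simpa [h] using hmn.1
  have : NoZeroDivisors (MonoidAlgebra k (FreeMonoid α)) :=
    ⟨fun {f g} h => by
      by_contra! h'
      exact (hmul f g h'.1 h'.2).1 h⟩
  have hupos : 0 < deg u := by
    by_contra! h
    refine hu ⟨u.coeff 1, ?_⟩
    ext w
    by_cases hw : w = 1
    · simp [hw, MonoidAlgebra.coe_algebraMap]
    · have : u.coeff w = 0 := by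
        by_contra hne
        have hle : w.length ≤ deg u :=
          Finset.le_sup (f := FreeMonoid.length) (Finsupp.mem_support_iff.2 hne)
        exact hw (FreeMonoid.length_eq_zero.1 (by omega))
      simp [this, MonoidAlgebra.coe_algebraMap, Ne.symm hw]
  have hu0 : u ≠ 0 := by
    rintro rfl
    simp [deg] at hupos
  obtain ⟨w, hw⟩ := MonoidAlgebra.exists_isGreatest_support hu0
  have hcomm : ∀ {f : MonoidAlgebra k (FreeMonoid α)} {m}, Commute f u →
      IsGreatest (f.coeff.support : Set (FreeMonoid α)) m → Commute m w := by
    intro f m hf hm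
    have h1 := MonoidAlgebra.isGreatest_support_mul hm hw
    rw [hf.eq] at h1
    exact h1.unique (MonoidAlgebra.isGreatest_support_mul hw hm)
  refine commute_of_commute_of_degree (k := k) deg (by simp [deg])
    (fun f g hf hg => (hmul f g hf hg).2) ?_ u hupos ?_ ha hb
  · intro f g
    refine Finset.sup_le fun x hx => ?_
    rw [MonoidAlgebra.coeff_sub] at hx
    rcases Finset.mem_union.1 (Finsupp.support_sub hx) with h | h
    · exact le_max_of_le_left (Finset.le_sup (f := FreeMonoid.length) h)
    · exact le_max_of_le_right (Finset.le_sup (f := FreeMonoid.length) h)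
  · intro f g hf hg hfu hgu hfg
    obtain ⟨m, hm⟩ := MonoidAlgebra.exists_isGreatest_support hf
    obtain ⟨n, hn⟩ := MonoidAlgebra.exists_isGreatest_support hg
    have hwpos : 0 < w.length := by rwa [← hdeg hw]
    have hinj : ∀ {x y}, Commute x w → Commute y w → x.length = y.length → x = y :=
      FreeMonoid.eq_of_commute_of_length_eq hwpos
    rw [hdeg hm, hdeg hn] at hfg
    obtain rfl : m = n := hinj (hcomm hfu hm) (hcomm hgu hn) hfg
    -- This scalar cancels `m`. The new leading word still commutes with `w`, so having the length
    -- of `m` would make it equal to `m`.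
    refine ⟨f.coeff m / g.coeff m, or_iff_not_imp_left.2 fun hne => ?_⟩
    obtain ⟨v, hv⟩ := MonoidAlgebra.exists_isGreatest_support hne
    have hvw := hcomm (hfu.sub_left (hgu.smul_left _)) hv
    have hvm : v ≠ m := by
      rintro rfl
      have h := Finsupp.mem_support_iff.1 hv.1
      have h' := Finsupp.mem_support_iff.1 hn.1
      simp [h'] at h
    have hle : v.length ≤ m.length := by
      have hv1 := hv.1
      rw [Finset.mem_coe, MonoidAlgebra.coeff_sub, MonoidAlgebra.coeff_smul] at hv1
      rcases Finset.mem_union.1 (Finsupp.support_sub hv1) with h | h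
      · exact hdeg hm ▸ Finset.le_sup (f := FreeMonoid.length) h
      · exact hdeg hn ▸ Finset.le_sup (f := FreeMonoid.length) (Finsupp.support_smul h)
    rw [hdeg hm, hdeg hv]
    exact lt_of_le_of_ne hle fun h => hvm (hinj hvw (hcomm hfu hm) h)

/-! ### Separating monomials of `⟨X⟩ * [Y]` in a free monoid. -/

/-- Finitely many exponent vectors are separated by an additive map to `ℕ`. -/
theorem Finsupp.exists_addMonoidHom_injOn {Y : Type*} (E : Finset (Y →₀ ℕ)) :
    ∃ n : (Y →₀ ℕ) →+ ℕ, Set.InjOn n E := by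
  classical
  suffices h : ∀ (F : Finset Y) (E : Finset (Y →₀ ℕ)), (∀ e ∈ E, e.support ⊆ F) →
      ∃ n : (Y →₀ ℕ) →+ ℕ, Set.InjOn n E from
    h (E.biUnion Finsupp.support) E fun e he => Finset.subset_biUnion_of_mem Finsupp.support he
  intro F
  induction F using Finset.induction_on with
  | empty =>
    intro E hE
    refine ⟨0, fun e he e' he' _ => ?_⟩
    rw [Finsupp.support_eq_empty.1 (Finset.subset_empty.1 (hE e he)),
      Finsupp.support_eq_empty.1 (Finset.subset_empty.1 (hE e' he'))]
  | insert y F _ ih =>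
    intro E hE
    obtain ⟨n, hn⟩ := ih (E.image (Finsupp.erase y)) (by
      intro e' he'
      obtain ⟨e, he, rfl⟩ := Finset.mem_image.1 he'
      rw [Finsupp.support_erase]
      exact Finset.subset_insert_iff.1 (hE e he))
    -- As `N` exceeds every exponent of `y`, that exponent is the last base-`N` digit of the new
    -- weight.
    let N := E.sup (fun e => e y) + 1
    have hN : ∀ e ∈ E, e y < N := fun e he =>
      Nat.lt_succ_of_le (Finset.le_sup (f := fun e : Y →₀ ℕ => e y) he)
    refine ⟨(AddMonoidHom.mulLeft N).comp (n.comp (Finsupp.eraseAddHom y)) +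
      Finsupp.applyAddHom y, fun e he e' he' h => ?_⟩
    have h' : N * n (Finsupp.erase y e) + e y = N * n (Finsupp.erase y e') + e' y := h
    have hy : e y = e' y := by
      have := congrArg (· % N) h'
      simpa [Nat.mul_add_mod, Nat.mod_eq_of_lt (hN e he), Nat.mod_eq_of_lt (hN e' he')] using this
    have her : Finsupp.erase y e = Finsupp.erase y e' := by
      refine hn (Finset.mem_image_of_mem _ he) (Finset.mem_image_of_mem _ he') ?_
      rw [hy, add_left_inj] at h'
      exact Nat.eq_of_mul_eq_mul_left (Nat.succ_pos _) h'
    rw [← Finsupp.single_add_erase y e, ← Finsupp.single_add_erase y e', hy, her]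

namespace CoprodMonoid

variable {X Y : Type*}

/-- The action of `⟨X⟩ * [Y]` on normal forms: the pair `(e₀, [(x₁, e₁), …, (xₙ, eₙ)])` stands for
the product `y ^ e₀ * x₁ * y ^ e₁ * ⋯ * xₙ * y ^ eₙ`. -/
noncomputable def normalFormAction (X Y : Type*) :
    CoprodMonoid X Y →* Function.End ((Y →₀ ℕ) × List (X × (Y →₀ ℕ))) :=
  Monoid.Coprod.lift
    (FreeMonoid.lift fun x w => (0, (x, w.1) :: w.2))
    { toFun := fun e w => (e.toAdd + w.1, w.2)
      map_one' := by
        funext w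
        exact Prod.ext (zero_add _) rfl
      map_mul' := fun e e' => by
        funext w
        exact Prod.ext (add_assoc _ _ _) rfl }

/-- The normal form of an element of `⟨X⟩ * [Y]`. -/
noncomputable def normalForm (m : CoprodMonoid X Y) : (Y →₀ ℕ) × List (X × (Y →₀ ℕ)) :=
  normalFormAction X Y m (0, [])

theorem normalFormAction_inl_of (x : X) (w : (Y →₀ ℕ) × List (X × (Y →₀ ℕ))) :
    normalFormAction X Y (Monoid.Coprod.inl (FreeMonoid.of x)) w = (0, (x, w.1) :: w.2) := by
  rw [normalFormAction, Monoid.Coprod.lift_apply_inl]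
  exact congrFun (FreeMonoid.lift_eval_of
    (M := Function.End ((Y →₀ ℕ) × List (X × (Y →₀ ℕ)))) _ x) w

theorem normalFormAction_inr (e : Multiplicative (Y →₀ ℕ))
    (w : (Y →₀ ℕ) × List (X × (Y →₀ ℕ))) :
    normalFormAction X Y (Monoid.Coprod.inr e) w = (e.toAdd + w.1, w.2) := by
  rw [normalFormAction, Monoid.Coprod.lift_apply_inr]
  rfl

/-- The value of a normal form in a monoid. -/
noncomputable def evalNormalForm {N : Type*} [Monoid N] (f : X → N) (g : Multiplicative (Y →₀ ℕ) →* N)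
    (w : (Y →₀ ℕ) × List (X × (Y →₀ ℕ))) : N :=
  g (.ofAdd w.1) * (w.2.map fun p => f p.1 * g (.ofAdd p.2)).prod

/-- Used with two targets: `⟨X⟩ * [Y]` itself, to recover `m` from its normal form, and the free
monoid on `Option X`, to compute the separating map. -/
theorem evalNormalForm_normalFormAction {N : Type*} [Monoid N] (f : X → N)
    (g : Multiplicative (Y →₀ ℕ) →* N) (m : CoprodMonoid X Y)
    (w : (Y →₀ ℕ) × List (X × (Y →₀ ℕ))) :
    evalNormalForm f g (normalFormAction X Y m w) =
      Monoid.Coprod.lift (FreeMonoid.lift f) g m * evalNormalForm f g w := by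
  induction m using Monoid.Coprod.induction_on generalizing w with
  | inl v =>
    induction v using FreeMonoid.inductionOn generalizing w with
    | one =>
      rw [map_one, map_one, map_one, one_mul]
      rfl
    | of x => simp [evalNormalForm, normalFormAction_inl_of, mul_assoc]
    | mul v v' ih ih' =>
      rw [map_mul, map_mul, map_mul]
      exact (ih _).trans (by rw [ih', mul_assoc])
  | inr e => simp [evalNormalForm, normalFormAction_inr, mul_assoc]
  | mul m m' ih ih' =>
    rw [map_mul, map_mul]
    exact (ih _).trans (by rw [ih', mul_assoc])

theorem evalNormalForm_normalForm {N : Type*} [Monoid N] (f : X → N)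
    (g : Multiplicative (Y →₀ ℕ) →* N) (m : CoprodMonoid X Y) :
    evalNormalForm f g (normalForm m) = Monoid.Coprod.lift (FreeMonoid.lift f) g m := by
  rw [normalForm, evalNormalForm_normalFormAction]
  simp [evalNormalForm]

theorem normalForm_injective :
    Function.Injective (normalForm : CoprodMonoid X Y → (Y →₀ ℕ) × List (X × (Y →₀ ℕ))) := by
  have h : Monoid.Coprod.lift (FreeMonoid.lift fun x => Monoid.Coprod.inl (FreeMonoid.of x))
      Monoid.Coprod.inr = MonoidHom.id (CoprodMonoid X Y) := by
    refine Monoid.Coprod.hom_ext ?_ ?_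
    · ext x
      simp
    · ext e
      simp
  intro m m' hm
  have := congrArg (evalNormalForm (fun x => Monoid.Coprod.inl (FreeMonoid.of x))
    Monoid.Coprod.inr) hm
  rwa [evalNormalForm_normalForm, evalNormalForm_normalForm, h] at this

theorem replicate_none_append_some_inj {a b : ℕ} {x x' : X} {s s' : List (Option X)}
    (h : List.replicate a none ++ some x :: s = List.replicate b none ++ some x' :: s') :
    a = b ∧ x = x' ∧ s = s' := by
  induction a generalizing b with
  | zero =>
    cases b with
    | zero => simpa using h
    | succ b => simp [List.replicate_succ] at h
  | succ a ih =>
    cases b with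
    | zero => simp [List.replicate_succ] at h
    | succ b =>
      simp only [List.replicate_succ, List.cons_append, List.cons.injEq, true_and] at h
      simpa using ih h

/-- The map sending a normal form to a word in `X` and one further letter is injective on normal
forms whose exponents are separated by the weight. -/
theorem evalNormalForm_injOn {n : (Y →₀ ℕ) →+ ℕ} {E : Set (Y →₀ ℕ)} (hn : Set.InjOn n E) :
    Set.InjOn (evalNormalForm (fun x : X => FreeMonoid.of (some x))
        ((powersHom _ (FreeMonoid.of none)).comp (AddMonoidHom.toMultiplicative n)))
      {w | w.1 ∈ E ∧ ∀ p ∈ w.2, p.2 ∈ E} := by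
  have hword (e : Y →₀ ℕ) (l : List (X × (Y →₀ ℕ))) :
      (evalNormalForm (fun x : X => FreeMonoid.of (some x))
        ((powersHom _ (FreeMonoid.of none)).comp (AddMonoidHom.toMultiplicative n))
          (e, l)).toList = List.replicate (n e) none ++
        l.flatMap fun p => some p.1 :: List.replicate (n p.2) none := by
    have hpow (a : ℕ) : (FreeMonoid.of (none : Option X) ^ a).toList = List.replicate a none := by
      induction a with
      | zero => rfl
      | succ a ih => rw [pow_succ', FreeMonoid.toList_mul, ih]; rfl
    have hprod : (l.map fun p : X × (Y →₀ ℕ) => FreeMonoid.of (some p.1) *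
        FreeMonoid.of (none : Option X) ^ n p.2).prod.toList =
        l.flatMap fun p => some p.1 :: List.replicate (n p.2) none := by
      induction l with
      | nil => rfl
      | cons p l ih => simp [FreeMonoid.toList_mul, hpow, ih]
    simp only [evalNormalForm]
    exact (FreeMonoid.toList_mul _ _).trans (congrArg₂ _ (hpow _) hprod)
  rintro ⟨e, l⟩ ⟨he, hl⟩ ⟨e', l'⟩ ⟨he', hl'⟩ h
  replace h := congrArg FreeMonoid.toList h
  rw [hword, hword] at h
  dsimp only at he hl he' hl'
  induction l generalizing e e' l' with
  | nil =>
    cases l' with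
    | nil => simpa using hn he he' (by simpa using congrArg List.length h)
    | cons p l' =>
      have := congrArg (some p.1 ∈ ·) h
      simp at this
  | cons p l ih =>
    cases l' with
    | nil =>
      have := congrArg (some p.1 ∈ ·) h
      simp at this
    | cons p' l' =>
      obtain ⟨h1, h2, h3⟩ := replicate_none_append_some_inj h
      -- What follows the first letter from `X` is the word of the normal form `(p.2, l)`.
      have h4 := ih p.2 (hl _ List.mem_cons_self) (fun q hq => hl q (List.mem_cons_of_mem _ hq))
        p'.2 l' (hl' _ List.mem_cons_self) (fun q hq => hl' q (List.mem_cons_of_mem _ hq)) h3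
      have h5 := hn he he' h1
      simp only [Prod.mk.injEq] at h4 ⊢
      exact ⟨h5, by rw [h4.2, Prod.ext h2 h4.1]⟩

/-- Finitely many elements of `⟨X⟩ * [Y]` are separated by a homomorphism to a free monoid. -/
theorem exists_monoidHom_freeMonoid_injOn (S : Finset (CoprodMonoid X Y)) :
    ∃ φ : CoprodMonoid X Y →* FreeMonoid (Option X), Set.InjOn φ S := by
  classical
  obtain ⟨n, hn⟩ := Finsupp.exists_addMonoidHom_injOn
    (S.biUnion fun m => insert (normalForm m).1 ((normalForm m).2.map Prod.snd).toFinset)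
  have hmem : ∀ m ∈ S, normalForm m ∈ {w : (Y →₀ ℕ) × List (X × (Y →₀ ℕ)) |
      w.1 ∈ (S.biUnion fun m => insert (normalForm m).1
        ((normalForm m).2.map Prod.snd).toFinset : Set (Y →₀ ℕ)) ∧
      ∀ p ∈ w.2, p.2 ∈ (S.biUnion fun m => insert (normalForm m).1
        ((normalForm m).2.map Prod.snd).toFinset : Set (Y →₀ ℕ))} := by
    intro m hm
    refine ⟨Finset.mem_biUnion.2 ⟨m, hm, Finset.mem_insert_self _ _⟩, fun p hp =>
      Finset.mem_biUnion.2 ⟨m, hm, Finset.mem_insert_of_mem ?_⟩⟩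
    exact List.mem_toFinset.2 (List.mem_map_of_mem hp)
  refine ⟨Monoid.Coprod.lift (FreeMonoid.lift fun x => FreeMonoid.of (some x))
    ((powersHom _ (FreeMonoid.of none)).comp (AddMonoidHom.toMultiplicative n)), ?_⟩
  intro m hm m' hm' h
  rw [← evalNormalForm_normalForm, ← evalNormalForm_normalForm] at h
  exact normalForm_injective (evalNormalForm_injOn hn (hmem m hm) (hmem m' hm') h)

end CoprodMonoid

/-! ### Reduction to the free algebra. -/

/-- In `k⟨X⟩ * k[Y]`, the centralizer of any nonscalar element is commutative. -/
theorem theorem1 (k X Y : Type*) [Field k] (u : FreePolyCoprod k X Y)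
    (hu : u ∉ Set.range (algebraMap k (FreePolyCoprod k X Y))) :
    ∀ a ∈ Subalgebra.centralizer k ({u} : Set (FreePolyCoprod k X Y)),
      ∀ b ∈ Subalgebra.centralizer k ({u} : Set (FreePolyCoprod k X Y)), a * b = b * a := by
  classical
  intro a ha b hb
  replace ha : Commute a u := (Subalgebra.mem_centralizer_iff k).1 ha u rfl |>.symm
  replace hb : Commute b u := (Subalgebra.mem_centralizer_iff k).1 hb u rfl |>.symm
  -- Including `1` keeps the image of `u` nonscalar, since scalars are supported there.
  obtain ⟨φ, hφ⟩ := CoprodMonoid.exists_monoidHom_freeMonoid_injOn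
    (insert 1 (u.coeff.support ∪ (a * b).coeff.support ∪ (b * a).coeff.support))
  have hinj : ∀ f g : FreePolyCoprod k X Y,
      f.coeff.support ⊆ insert 1 (u.coeff.support ∪ (a * b).coeff.support ∪
        (b * a).coeff.support) →
      g.coeff.support ⊆ insert 1 (u.coeff.support ∪ (a * b).coeff.support ∪
        (b * a).coeff.support) →
      MonoidAlgebra.mapDomain φ f = MonoidAlgebra.mapDomain φ g → f = g := by
    intro f g hf hg h
    exact MonoidAlgebra.coeff_injective (Finsupp.mapDomain_injOn _ hφ (Finset.coe_subset.2 hf)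
      (Finset.coe_subset.2 hg) (congrArg MonoidAlgebra.coeff h))
  have hcomm {c : FreePolyCoprod k X Y} (hc : Commute c u) :
      Commute (MonoidAlgebra.mapDomain φ c) (MonoidAlgebra.mapDomain φ u) :=
    hc.map (MonoidAlgebra.mapDomainRingHom k φ)
  refine hinj _ _ (fun x hx => by simp only [Finset.mem_insert, Finset.mem_union]; tauto)
    (fun x hx => by simp only [Finset.mem_insert, Finset.mem_union]; tauto) ?_
  rw [MonoidAlgebra.mapDomain_mul, MonoidAlgebra.mapDomain_mul]
  refine (FreeMonoid.commute_of_commute_monoidAlgebra ?_ (hcomm ha) (hcomm hb)).eq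
  rintro ⟨c, hc⟩
  refine hu ⟨c, hinj _ _ ?_ (fun x hx => by
    simp only [Finset.mem_insert, Finset.mem_union]; tauto) ?_⟩
  · intro x hx
    have h := Finsupp.support_single_subset (show x ∈ (Finsupp.single 1 c).support by
      simpa [MonoidAlgebra.coe_algebraMap] using hx)
    exact Finset.mem_insert.2 (Or.inl (Finset.mem_singleton.1 h))
  · rw [MonoidAlgebra.mapDomain_algebraMap, hc]
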